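/- Let $A$ be a nonempty finite set of positive integers and let $d=\max A$. For $n\ge 0$ let $\mathfrak S_n^{(A)}$ be the set of permutations of $[n]=\{1,\dots,n\}$ all of whose cycles have length in $A$ (fixed points being cycles of length $1$), and for a permutation $\sigma$ of $[n]$ let $N_l(\sigma)$ be the number of cycles of length $l$ of $\sigma$. For every $n$ such that $\mathfrak S_n^{(A)}\neq\emptyset$, let $\sigma_n$ be a random permutation, defined on some probability space (which may depend on $n$), whose law is the uniform distribution on $\mathfrak S_n^{(A)}$. Then, for every $l\in A$ and every $p\in[1,\infty)$, as $n\to\infty$ within the set of those $n$ for which $\mathfrak S_n^{(A)}\ne\emptyset$, $$\frac{N_l(\sigma_n)}{n^{l/d}}\longrightarrow \frac1l\quad\text{in } L^p,\qquad\text{i.e.}\qquad \mathbb E\left[\,\left|\frac{N_l(\sigma_n)}{n^{l/d}}-\frac1l\right|^p\,\right]\longrightarrow 0 .$$ Consequently the cycles of length $d$ cover asymptotically all of $[n]$: if $C_n$ denotes the number of elements of $[n]$ that belong to a cycle of length $d$ of $\sigma_n$, then, along the same integers $n$, $C_n/n\to 1$ in $L^p$ for every $p\in[1,\infty)$. -/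

import Mathlib

open MeasureTheory ProbabilityTheory Filter Topology
open scoped ENNReal

/-- The finite group of permutations of an `n`-element set carries the discrete σ-algebra. -/
instance permFinMeasurableSpace (n : ℕ) : MeasurableSpace (Equiv.Perm (Fin n)) := ⊤

/-- `numCycles l σ` is the number `N_l(σ)` of cycles of length `l` of `σ`. Here `σ.partition` is the
cycle type of `σ` in which every fixed point counts as a cycle of length `1`. -/
def numCycles {n : ℕ} (l : ℕ) (σ : Equiv.Perm (Fin n)) : ℕ :=
  σ.partition.parts.count l

/-- The set of permutations of an `n`-element set all of whose cycles (fixed points being cycles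
of length `1`) have length in `A`. -/
def permsWithCycleLengthsIn (A : Finset ℕ) (n : ℕ) : Set (Equiv.Perm (Fin n)) :=
  {σ | ∀ k ∈ σ.partition.parts, k ∈ A}

/-- The set of points that lie on a cycle of `σ` of length `l`. -/
def pointsOnCycles {n : ℕ} (l : ℕ) (σ : Equiv.Perm (Fin n)) : Set (Fin n) :=
  {i | Set.ncard {j | σ.SameCycle i j} = l}

/-- The integers `n` for which some permutation of an `n`-element set has all its cycle lengths
in `A`. -/
def admissibleSizes (A : Finset ℕ) : Set ℕ :=
  {n | (permsWithCycleLengthsIn A n).Nonempty}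

/-- Convergence in `L^p` to the constant `c`, as `n → ∞` inside the set `S`, of real random
variables `X n`, each living on a probability space `(Ω n, P n)` of its own. -/
def TendstoConstInLp {Ω : ℕ → Type*} [∀ n, MeasurableSpace (Ω n)] (P : ∀ n, Measure (Ω n))
    (S : Set ℕ) (X : ∀ n, Ω n → ℝ) (c : ℝ) (p : ℝ≥0∞) : Prop :=
  (∀ n ∈ S, MemLp (X n) p (P n)) ∧
    Tendsto (fun n => eLpNorm (fun ω => X n ω - c) p (P n)) (atTop ⊓ 𝓟 S) (𝓝 0)

/-! By Cauchy's formula a cycle type with multiplicities `m l` has n! / ∏ l^(m l) (m l)!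
permutations. So, for any x > 0, the cycle counts of a uniform element behave like independent
Poisson variables of means x^l/l conditioned on ∑ l · m l = n. Choose x as the saddle point ∑ x^l =
n, where the constraint holds in mean.

No local limit theorem is needed: conditioning costs only a factor polynomial in n. Dropping the
constraint gives an upper bound on the generating function (`sum_prod_pow_numCycles_le`).
Conversely, one admissible cycle type at bounded distance from the means already carries a
polynomially small share of the unconstrained mass (`factorial_mul_exp_sum_le`). The ratio of the
two bounds yields Poisson-type Chernoff estimates, with error exp(-c x) up to that factor. As n ≤
|A| x^d, the exponential wins, so N_l is close to x^l/l, and x^l is asymptotic to n^(l/d). The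
deviation never exceeds n + 1, so the bad event is negligible in L^p too. Coverage follows from C_n
= d · N_d. -/

/-! ### Counting permutations by cycle type -/

lemma partition_parts_eq_filter_add {n : ℕ} (q : n.Partition) :
    q.parts = q.parts.filter (2 ≤ ·) + Multiset.replicate (q.parts.count 1) 1 := by
  conv_lhs => rw [← Multiset.filter_add_not (2 ≤ ·) q.parts]
  congr 1
  rw [← Multiset.filter_eq' q.parts 1]
  refine Multiset.filter_congr fun x hx => ?_
  have := q.parts_pos hx
  omega

lemma partition_mul_count_le {n : ℕ} (q : n.Partition) (l : ℕ) : l * q.parts.count l ≤ n := by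
  have h : Multiset.replicate (q.parts.count l) l ≤ q.parts :=
    Multiset.le_count_iff_replicate_le.1 le_rfl
  obtain ⟨t, ht⟩ := Multiset.le_iff_exists_add.1 h
  have hs := congrArg Multiset.sum ht
  rw [q.parts_sum, Multiset.sum_add, Multiset.sum_replicate, smul_eq_mul, mul_comm] at hs
  omega

/-- Cauchy's formula for the number of permutations with a given partition. -/
lemma card_partition_eq_mul {α : Type*} [Fintype α] [DecidableEq α]
    (q : (Fintype.card α).Partition) (A : Finset ℕ) (hA : ∀ k ∈ q.parts, k ∈ A) :
    (Finset.univ.filter fun σ : Equiv.Perm α => σ.partition = q).card *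
      ∏ l ∈ A, (l ^ q.parts.count l * (q.parts.count l).factorial) =
        (Fintype.card α).factorial := by
  set m := q.parts.filter (2 ≤ ·) with hm
  have hq := partition_parts_eq_filter_add q
  rw [← hm] at hq
  have hsum : m.sum + q.parts.count 1 = Fintype.card α := by
    have h := congrArg Multiset.sum hq
    rw [q.parts_sum] at h
    simpa using h.symm
  have key := Equiv.Perm.card_of_cycleType_mul_eq α m
  rw [if_pos ⟨by omega, fun a ha => (Multiset.mem_filter.1 ha).2⟩] at key
  have hset : (Finset.univ.filter fun σ : Equiv.Perm α => σ.partition = q) =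
      Finset.univ.filter fun σ : Equiv.Perm α => σ.cycleType = m := by
    ext σ
    simp only [Finset.mem_filter, Finset.mem_univ, true_and]
    constructor
    · rintro rfl
      rw [hm, Equiv.Perm.filter_parts_partition_eq_cycleType]
    · intro h
      rw [Nat.Partition.ext_iff, Equiv.Perm.parts_partition, h, hq, ← Equiv.Perm.sum_cycleType, h]
      congr 2
      omega
  rw [hset, ← key, mul_assoc]
  congr 1
  have h1 : Fintype.card α - m.sum = q.parts.count 1 := by omega
  have hsub : q.parts.toFinset ⊆ A := fun k hk => hA k (Multiset.mem_toFinset.1 hk)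
  rw [Finset.prod_mul_distrib, h1]
  have hprod : ∏ l ∈ A, l ^ q.parts.count l = m.prod := by
    rw [← Finset.prod_subset hsub, ← Finset.prod_multiset_count]
    · rw [hq]; simp
    · intro x _ hx
      rw [Multiset.count_eq_zero_of_notMem (by simpa using hx), pow_zero]
  have hfact : ∏ l ∈ A, (q.parts.count l).factorial =
      (q.parts.count 1).factorial * ∏ l ∈ m.toFinset, (m.count l).factorial := by
    -- Fixed points are treated apart from `m`. If 1 is not in `A`, inserting it only adds a factor
    -- 0! = 1.
    have hsub' : insert 1 m.toFinset ⊆ insert 1 A := by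
      refine Finset.insert_subset_insert _ fun k hk => ?_
      exact hA k (Multiset.mem_filter.1 (Multiset.mem_toFinset.1 hk)).1
    have h1m : 1 ∉ m.toFinset := by simp [hm]
    have e1 : ∏ l ∈ A, (q.parts.count l).factorial =
        ∏ l ∈ insert 1 A, (q.parts.count l).factorial := by
      refine Finset.prod_subset (Finset.subset_insert _ _) fun x _ hx => ?_
      rw [Multiset.count_eq_zero_of_notMem fun h => hx (hA x h), Nat.factorial_zero]
    rw [e1, ← Finset.prod_subset hsub', Finset.prod_insert h1m]
    · congr 1
      refine Finset.prod_congr rfl fun l hl => ?_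
      have : 2 ≤ l := (Multiset.mem_filter.1 (Multiset.mem_toFinset.1 hl)).2
      rw [hm, Multiset.count_filter_of_pos this]
    · intro x _ hx
      simp only [Finset.mem_insert, Multiset.mem_toFinset, hm, Multiset.mem_filter, not_or,
        not_and, not_le] at hx
      rw [Multiset.count_eq_zero_of_notMem, Nat.factorial_zero]
      intro h
      have := hx.2 h
      have := q.parts_pos h
      omega
  rw [hprod, hfact]
  ring

open Classical in
/-- Exponential-formula upper bound for the cycle-count generating function. -/
lemma sum_prod_pow_numCycles_le (A : Finset ℕ) (hpos : ∀ a ∈ A, 0 < a) (n : ℕ) (u : ℕ → ℝ)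
    (hu : ∀ l, 0 ≤ u l) :
    ∑ σ ∈ Finset.univ.filter (· ∈ permsWithCycleLengthsIn A n),
        ∏ l ∈ A, u l ^ numCycles l σ ≤
      n.factorial * ∏ l ∈ A, Real.exp (u l / l) := by
  set T := Finset.univ.filter fun q : (Fintype.card (Fin n)).Partition => ∀ k ∈ q.parts, k ∈ A
    with hT
  have hmaps : ∀ σ ∈ Finset.univ.filter (· ∈ permsWithCycleLengthsIn A n), σ.partition ∈ T := by
    intro σ hσ
    exact Finset.mem_filter.2 ⟨Finset.mem_univ _, (Finset.mem_filter.1 hσ).2⟩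
  have hcount : ∀ q ∈ T, ∀ l ∈ A, q.parts.count l ≤ n := by
    intro q _ l hl
    have h := (partition_mul_count_le q l).trans_eq (Fintype.card_fin n)
    exact (Nat.le_mul_of_pos_left _ (hpos l hl)).trans h
  rw [← Finset.sum_fiberwise_of_maps_to hmaps]
  have step : ∀ q ∈ T, ∑ σ ∈ (Finset.univ.filter (· ∈ permsWithCycleLengthsIn A n)).filter
      (fun σ => σ.partition = q), ∏ l ∈ A, u l ^ numCycles l σ =
      n.factorial * ∏ l ∈ A, ((u l / l) ^ q.parts.count l / (q.parts.count l).factorial) := by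
    intro q hq
    have hqA : ∀ k ∈ q.parts, k ∈ A := by simpa [hT] using hq
    have hset : (Finset.univ.filter (· ∈ permsWithCycleLengthsIn A n)).filter
        (fun σ => σ.partition = q) = Finset.univ.filter fun σ => σ.partition = q := by
      ext σ
      simp only [Finset.mem_filter, Finset.mem_univ, true_and, and_iff_right_iff_imp]
      rintro rfl
      exact hqA
    rw [hset, Finset.sum_congr rfl (g := fun _ => ∏ l ∈ A, u l ^ q.parts.count l), Finset.sum_const,
      nsmul_eq_mul]
    · have hcard := card_partition_eq_mul (α := Fin n) q A hqA
      have hcard' : ((Finset.univ.filter fun σ : Equiv.Perm (Fin n) => σ.partition = q).card : ℝ) *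
          ∏ l ∈ A, ((l : ℝ) ^ q.parts.count l * ((q.parts.count l).factorial : ℝ)) =
          (n.factorial : ℝ) := by
        have := congrArg (Nat.cast (R := ℝ))
          (hcard.trans (congrArg Nat.factorial (Fintype.card_fin n)))
        rw [← this]
        push_cast
        rfl
      rw [← hcard', mul_assoc, ← Finset.prod_mul_distrib]
      congr 1
      refine Finset.prod_congr rfl fun l hl => ?_
      have : (l : ℝ) ≠ 0 := by exact_mod_cast (hpos l hl).ne'
      have : ((q.parts.count l).factorial : ℝ) ≠ 0 := by positivity
      rw [div_pow]
      field_simp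
    · intro σ hσ
      rw [Finset.mem_filter] at hσ
      simp only [numCycles]
      rw [hσ.2]
  rw [Finset.sum_congr rfl step, ← Finset.mul_sum]
  gcongr
  -- A partition is determined by its multiplicities; letting these range freely over a box drops
  -- the constraint and factorises the sum into truncated exponential series.
  calc ∑ q ∈ T, ∏ l ∈ A, ((u l / l) ^ q.parts.count l / ((q.parts.count l).factorial : ℝ))
      = ∑ f ∈ T.image (fun q (l : ℕ) (_ : l ∈ A) => q.parts.count l),
          ∏ l ∈ A.attach, ((u l / l) ^ f l.1 l.2 / ((f l.1 l.2).factorial : ℝ)) := by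
        rw [Finset.sum_image]
        · refine Finset.sum_congr rfl fun q _ => ?_
          exact (Finset.prod_attach A
            (fun l => (u l / l) ^ q.parts.count l / ((q.parts.count l).factorial : ℝ))).symm
        · intro q hq r hr h
          have hqA : ∀ k ∈ q.parts, k ∈ A := by simpa [hT] using hq
          have hrA : ∀ k ∈ r.parts, k ∈ A := by simpa [hT] using hr
          rw [Nat.Partition.ext_iff]
          ext l
          by_cases hl : l ∈ A
          · exact congrFun (congrFun h l) hl
          · rw [Multiset.count_eq_zero_of_notMem fun h => hl (hqA l h),
              Multiset.count_eq_zero_of_notMem fun h => hl (hrA l h)]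
    _ ≤ ∑ f ∈ A.pi (fun _ => Finset.range (n + 1)),
          ∏ l ∈ A.attach, ((u l / l) ^ f l.1 l.2 / ((f l.1 l.2).factorial : ℝ)) := by
        refine Finset.sum_le_sum_of_subset_of_nonneg ?_ fun f _ _ => ?_
        · intro f hf
          obtain ⟨q, hq, rfl⟩ := Finset.mem_image.1 hf
          rw [Finset.mem_pi]
          intro l hl
          rw [Finset.mem_range]
          have := hcount q hq l hl
          omega
        · refine Finset.prod_nonneg fun l _ => ?_
          have := hu l
          positivity
    _ = ∏ l ∈ A, ∑ j ∈ Finset.range (n + 1), ((u l / l) ^ j / (j.factorial : ℝ)) := by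
        rw [Finset.prod_sum]
    _ ≤ ∏ l ∈ A, Real.exp (u l / l) := by
        refine Finset.prod_le_prod (fun l _ => Finset.sum_nonneg fun j _ => ?_) fun l _ => ?_
        · have := hu l
          positivity
        · exact Real.sum_le_exp_of_nonneg (div_nonneg (hu l) (Nat.cast_nonneg l)) _

open Classical in
-- Keeps the single conjugacy class with multiplicities `m` in Cauchy's formula.
lemma factorial_le_card_mul_prod (A : Finset ℕ) (hpos : ∀ a ∈ A, 0 < a) (n : ℕ) (m : ℕ → ℕ)
    (hm : ∑ l ∈ A, l * m l = n) :
    n.factorial ≤ (Finset.univ.filter (· ∈ permsWithCycleLengthsIn A n)).card *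
      ∏ l ∈ A, (l ^ m l * (m l).factorial) := by
  let s : Multiset ℕ := ∑ l ∈ A, Multiset.replicate (m l) l
  have hmem : ∀ k ∈ s, k ∈ A := by
    intro k hk
    obtain ⟨l, hl, hk⟩ := Multiset.mem_sum.1 hk
    rwa [Multiset.eq_of_mem_replicate hk]
  have hcount : ∀ l ∈ A, s.count l = m l := by
    intro l hl
    simp only [s, Multiset.count_sum', Multiset.count_replicate]
    rw [Finset.sum_ite_eq' A l m, if_pos hl]
  let q : (Fintype.card (Fin n)).Partition :=
    { parts := s
      parts_pos := fun {k} hk => hpos k (hmem k hk)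
      parts_sum := by
        rw [Fintype.card_fin, ← hm]
        simp only [s, Multiset.sum_sum, Multiset.sum_replicate, smul_eq_mul, mul_comm] }
  have key := (card_partition_eq_mul q A hmem).trans
    (congrArg Nat.factorial (Fintype.card_fin n))
  rw [← key]
  have e : ∏ l ∈ A, (l ^ q.parts.count l * (q.parts.count l).factorial) =
      ∏ l ∈ A, (l ^ m l * (m l).factorial) :=
    Finset.prod_congr rfl fun l hl => by rw [show q.parts.count l = m l from hcount l hl]
  rw [e]
  refine Nat.mul_le_mul_right _ (Finset.card_le_card fun σ hσ => ?_)
  rw [Finset.mem_filter] at hσ ⊢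
  refine ⟨Finset.mem_univ _, ?_⟩
  change ∀ k ∈ σ.partition.parts, k ∈ A
  rw [hσ.2]
  exact hmem

lemma sum_mul_numCycles (A : Finset ℕ) {n : ℕ} (σ : Equiv.Perm (Fin n))
    (hσ : σ ∈ permsWithCycleLengthsIn A n) : ∑ l ∈ A, l * numCycles l σ = n := by
  have h := σ.partition.parts_sum.trans (Fintype.card_fin n)
  conv_rhs => rw [← h, Finset.sum_multiset_count]
  symm
  simp only [numCycles, smul_eq_mul, mul_comm]
  refine Finset.sum_subset (fun k hk => hσ k (Multiset.mem_toFinset.1 hk)) fun x _ hx => ?_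
  rw [Multiset.count_eq_zero_of_notMem (by simpa using hx), mul_zero]

lemma mul_numCycles_le {n : ℕ} (l : ℕ) (σ : Equiv.Perm (Fin n)) : l * numCycles l σ ≤ n :=
  (partition_mul_count_le σ.partition l).trans_eq (Fintype.card_fin n)

/-- For l ≥ 2 the points form the disjoint union of the supports of the cycle factors of length l.
Fixed points are not cycle factors, so l = 1 is separate. -/
lemma ncard_pointsOnCycles {n : ℕ} {l : ℕ} (hl : 0 < l) (σ : Equiv.Perm (Fin n)) :
    (pointsOnCycles l σ).ncard = l * numCycles l σ := by
  classical
  have hfix : ∀ i, σ i = i → {j | σ.SameCycle i j} = {i} := by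
    intro i hi
    ext j
    simp only [Set.mem_ofPred_eq, Set.mem_singleton_iff]
    refine ⟨fun h => ?_, fun h => h ▸ Equiv.Perm.SameCycle.refl _ _⟩
    exact (h.eq_of_left hi).symm
  have hmov : ∀ i, σ i ≠ i → {j | σ.SameCycle i j} = ((σ.cycleOf i).support : Set (Fin n)) := by
    intro i hi
    ext j
    simp [Equiv.Perm.mem_support_cycleOf_iff' hi]
  rcases eq_or_ne l 1 with rfl | hl1
  · have h1 : pointsOnCycles 1 σ = ((σ.supportᶜ : Finset (Fin n)) : Set (Fin n)) := by
      ext i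
      simp only [pointsOnCycles, Set.mem_ofPred_eq, Finset.coe_compl, Set.mem_compl_iff,
        Finset.mem_coe, Equiv.Perm.mem_support, not_not]
      by_cases hi : σ i = i
      · simp [hfix i hi, hi]
      · rw [hmov i hi, Set.ncard_coe_finset]
        simp only [hi, iff_false]
        have := Equiv.Perm.two_le_card_support_cycleOf_iff.2 hi
        omega
    rw [h1, Set.ncard_coe_finset, Finset.card_compl, numCycles, Equiv.Perm.parts_partition,
      Multiset.count_add, Multiset.count_replicate_self, Multiset.count_eq_zero_of_notMem]
    · omega
    · intro h
      exact absurd (Equiv.Perm.two_le_of_mem_cycleType h) (by norm_num)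
  · have h1 : pointsOnCycles l σ = (((σ.cycleFactorsFinset.filter
        (fun c => c.support.card = l)).biUnion Equiv.Perm.support : Finset (Fin n)) :
        Set (Fin n)) := by
      ext i
      simp only [pointsOnCycles, Set.mem_ofPred_eq, Finset.mem_coe, Finset.mem_biUnion,
        Finset.mem_filter]
      by_cases hi : σ i = i
      · rw [hfix i hi, Set.ncard_singleton]
        refine ⟨fun h => absurd h.symm hl1, ?_⟩
        rintro ⟨c, ⟨hc, _⟩, hic⟩
        exact absurd hi (Equiv.Perm.mem_support.1 (Equiv.Perm.mem_cycleFactorsFinset_support_le hc hic))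
      · rw [hmov i hi, Set.ncard_coe_finset]
        constructor
        · intro h
          refine ⟨σ.cycleOf i, ⟨Equiv.Perm.cycleOf_mem_cycleFactorsFinset_iff.2
            (Equiv.Perm.mem_support.2 hi), h⟩, ?_⟩
          rw [Equiv.Perm.mem_support_cycleOf_iff' hi]
        · rintro ⟨c, ⟨hc, hcl⟩, hic⟩
          rwa [← Equiv.Perm.cycle_is_cycleOf hic hc]
    rw [h1, Set.ncard_coe_finset, Finset.card_biUnion]
    · rw [Finset.sum_congr rfl (g := fun _ => l) (fun c hc => (Finset.mem_filter.1 hc).2),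
        Finset.sum_const, smul_eq_mul, mul_comm, numCycles, Equiv.Perm.parts_partition,
        Multiset.count_add, Multiset.count_replicate, if_neg (Ne.symm hl1), add_zero,
        Equiv.Perm.cycleType_def, Multiset.count_map, Finset.card_def, Finset.filter_val]
      congr 2
      refine Multiset.filter_congr fun c _ => ?_
      simp [eq_comm]
    · intro c hc c' hc' hne
      have h := Equiv.Perm.cycleFactorsFinset_pairwise_disjoint σ
        (Finset.mem_filter.1 hc).1 (Finset.mem_filter.1 hc').1 hne
      exact h.disjoint_support

/-! ### Poisson masses and an admissible cycle type near the means -/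

/-- A weak Stirling bound; the induction step is (k/(k+1))^(k+1) ≤ 1/e. -/
lemma factorial_le_mul_pow_mul_exp {m : ℕ} (hm : 1 ≤ m) :
    (m.factorial : ℝ) ≤ m * (m : ℝ) ^ m * Real.exp (1 - m) := by
  induction m, hm using Nat.le_induction with
  | base => simp
  | succ k hk ih =>
    have hk0 : (0 : ℝ) < k := by exact_mod_cast hk
    have h1 : (k : ℝ) / (k + 1) ≤ Real.exp (-(1 / (k + 1))) := by
      have := Real.add_one_le_exp (-(1 / ((k : ℝ) + 1)))
      refine le_trans (le_of_eq ?_) this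
      field_simp
      ring
    have h2 : ((k : ℝ) / (k + 1)) ^ (k + 1) ≤ Real.exp (-1) := by
      refine (pow_le_pow_left₀ (by positivity) h1 (k + 1)).trans (le_of_eq ?_)
      rw [← Real.exp_nat_mul]
      congr 1
      push_cast
      field_simp
    rw [div_pow, div_le_iff₀ (by positivity)] at h2
    rw [Nat.factorial_succ]
    push_cast
    calc ((k : ℝ) + 1) * (k.factorial : ℝ)
        ≤ (k + 1) * (k * (k : ℝ) ^ k * Real.exp (1 - k)) := by gcongr
      _ = (k + 1) * (k : ℝ) ^ (k + 1) * Real.exp (1 - k) := by ring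
      _ ≤ (k + 1) * (Real.exp (-1) * ((k : ℝ) + 1) ^ (k + 1)) * Real.exp (1 - k) := by gcongr
      _ = (k + 1) * ((k : ℝ) + 1) ^ (k + 1) * (Real.exp (-1) * Real.exp (1 - k)) := by ring
      _ = (k + 1) * ((k : ℝ) + 1) ^ (k + 1) * Real.exp (1 - (k + 1)) := by
        rw [← Real.exp_add]
        congr 2
        ring

/-- A lower bound for the Poisson mass e^(-r) r^m / m!, polynomial in m when (m - r)²/r is bounded.
It combines Stirling with m/r ≤ exp(m/r - 1) and m(m/r - 1) = (m - r) + (m - r)²/r. -/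
lemma factorial_mul_exp_le {r : ℝ} (hr : 0 < r) (m : ℕ) :
    (m.factorial : ℝ) * Real.exp r ≤ r ^ m * ((m + 1) * Real.exp (1 + (m - r) ^ 2 / r)) := by
  rcases Nat.eq_zero_or_pos m with rfl | hm
  · simp only [Nat.factorial_zero, Nat.cast_one, one_mul, pow_zero, Nat.cast_zero, zero_add,
      zero_sub, neg_sq]
    rw [sq, mul_div_assoc, div_self hr.ne']
    exact Real.exp_le_exp.2 (by linarith)
  · have h1 : (m : ℝ) / r ≤ Real.exp (m / r - 1) := by
      have := Real.add_one_le_exp ((m : ℝ) / r - 1)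
      linarith
    have h2 : ((m : ℝ) / r) ^ m ≤ Real.exp ((m - r) + (m - r) ^ 2 / r) := by
      refine (pow_le_pow_left₀ (by positivity) h1 m).trans (le_of_eq ?_)
      rw [← Real.exp_nat_mul]
      congr 1
      field_simp
      ring
    rw [div_pow, div_le_iff₀ (by positivity)] at h2
    calc (m.factorial : ℝ) * Real.exp r
        ≤ (m * (m : ℝ) ^ m * Real.exp (1 - m)) * Real.exp r := by
          gcongr
          exact factorial_le_mul_pow_mul_exp hm
      _ ≤ ((m + 1) * (Real.exp ((m - r) + (m - r) ^ 2 / r) * r ^ m) * Real.exp (1 - m)) *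
          Real.exp r := by
          gcongr
          linarith
      _ = r ^ m * ((m + 1) * (Real.exp ((m - r) + (m - r) ^ 2 / r) * Real.exp (1 - m) *
          Real.exp r)) := by ring
      _ = r ^ m * ((m + 1) * Real.exp (1 + (m - r) ^ 2 / r)) := by
          rw [← Real.exp_add, ← Real.exp_add]
          congr 3
          ring

/-- Rounds the real solution `r` to an integral one. The known solution `k` settles the arithmetic:
rounding within the residue classes of `k` modulo d leaves a defect divisible by d, which the
coordinate at d absorbs. -/
lemma exists_sum_mul_eq_and_abs_sub_le (A : Finset ℕ) {d : ℕ} (hdA : d ∈ A) (hd0 : 0 < d)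
    (hd : ∀ l ∈ A, l ≤ d) {n : ℕ} (k : ℕ → ℕ) (hk : ∑ l ∈ A, l * k l = n) (r : ℕ → ℝ)
    (hr : ∀ l, 0 ≤ r l) (hsum : ∑ l ∈ A, (l : ℝ) * r l = n) (hbig : (A.card * d : ℝ) ≤ r d) :
    ∃ m : ℕ → ℕ, ∑ l ∈ A, l * m l = n ∧ ∀ l ∈ A, |(m l : ℝ) - r l| ≤ A.card * d := by
  have hdR : (0 : ℝ) < d := by exact_mod_cast hd0
  have hcard : (1 : ℝ) ≤ A.card := by exact_mod_cast Finset.card_pos.2 ⟨d, hdA⟩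
  let m' : ℕ → ℕ := fun l => d * ⌊r l / d⌋₊ + k l % d
  have hm' : ∀ l, |(m' l : ℝ) - r l| ≤ d := by
    intro l
    have h1 : (⌊r l / d⌋₊ : ℝ) ≤ r l / d := Nat.floor_le (div_nonneg (hr l) hdR.le)
    have h2 : r l / d < ⌊r l / d⌋₊ + 1 := Nat.lt_floor_add_one _
    rw [le_div_iff₀ hdR] at h1
    rw [div_lt_iff₀ hdR] at h2
    have h3 : ((k l % d : ℕ) : ℝ) < d := by exact_mod_cast Nat.mod_lt _ hd0
    have h4 : (0 : ℝ) ≤ ((k l % d : ℕ) : ℝ) := Nat.cast_nonneg _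
    have h5 : (m' l : ℝ) = d * (⌊r l / d⌋₊ : ℝ) + ((k l % d : ℕ) : ℝ) := by
      simp only [m', Nat.cast_add, Nat.cast_mul]
    rw [h5, abs_le]
    constructor <;> nlinarith
  have hdvd : (d : ℤ) ∣ (n : ℤ) - ∑ l ∈ A.erase d, (l : ℤ) * (m' l : ℤ) := by
    have e : (n : ℤ) = d * k d + ∑ l ∈ A.erase d, (l : ℤ) * (k l : ℤ) := by
      rw [Finset.add_sum_erase A (fun l : ℕ => (l : ℤ) * (k l : ℤ)) hdA, ← hk]
      push_cast
      rfl
    rw [e, add_sub_assoc, ← Finset.sum_sub_distrib]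
    refine dvd_add (dvd_mul_right _ _) (Finset.dvd_sum fun l _ => ?_)
    rw [← mul_sub]
    refine Dvd.dvd.mul_left ?_ _
    have h := Int.emod_add_mul_ediv (k l : ℤ) d
    refine ⟨(k l : ℤ) / d - (⌊r l / d⌋₊ : ℤ), ?_⟩
    simp only [m', Nat.cast_add, Nat.cast_mul, Int.natCast_mod]
    linear_combination -h
  obtain ⟨z, hz⟩ := hdvd
  have hzR : (n : ℝ) - ∑ l ∈ A.erase d, (l : ℝ) * (m' l : ℝ) = d * z := by exact_mod_cast hz
  have hdiff : d * ((z : ℝ) - r d) = ∑ l ∈ A.erase d, (l : ℝ) * (r l - m' l) := by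
    rw [← Finset.add_sum_erase A _ hdA] at hsum
    simp only [mul_sub, Finset.sum_sub_distrib]
    linarith
  have hzabs : |(z : ℝ) - r d| ≤ A.card * d := by
    have h : |d * ((z : ℝ) - r d)| ≤ A.card * (d * d) := by
      rw [hdiff]
      refine (Finset.abs_sum_le_sum_abs _ _).trans ?_
      calc ∑ l ∈ A.erase d, |(l : ℝ) * (r l - m' l)| ≤ ∑ l ∈ A.erase d, (d * d : ℝ) := by
            refine Finset.sum_le_sum fun l hl => ?_
            rw [abs_mul, Nat.abs_cast, abs_sub_comm]
            have : (l : ℝ) ≤ d := by exact_mod_cast hd l (Finset.mem_of_mem_erase hl)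
            exact mul_le_mul this (hm' l) (abs_nonneg _) hdR.le
        _ = (A.erase d).card * (d * d : ℝ) := by rw [Finset.sum_const, nsmul_eq_mul]
        _ ≤ A.card * (d * d : ℝ) := by
            gcongr
            exact Finset.erase_subset _ _
    rw [abs_mul, Nat.abs_cast] at h
    refine le_of_mul_le_mul_left (h.trans (le_of_eq ?_)) hdR
    ring
  -- Largeness of `r d` is what keeps the corrected coordinate nonnegative.
  have hz0 : 0 ≤ z := by
    have := (abs_le.1 hzabs).1
    have h : (0 : ℝ) ≤ z := by linarith
    exact_mod_cast h
  lift z to ℕ using hz0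
  refine ⟨fun l => if l = d then z else m' l, ?_, fun l hl => ?_⟩
  · rw [← Finset.add_sum_erase A _ hdA]
    simp only [if_true]
    have e : ∑ l ∈ A.erase d, l * (if l = d then z else m' l) = ∑ l ∈ A.erase d, l * m' l :=
      Finset.sum_congr rfl fun l hl => by rw [if_neg (Finset.ne_of_mem_erase hl)]
    rw [e]
    zify
    linarith
  · by_cases h : l = d
    · subst h
      simpa using hzabs
    · simp only [if_neg h]
      refine (hm' l).trans ?_
      nlinarith

/-! ### Saddle-point comparison and Chernoff bounds -/

open Classical in
/-- At the saddle point `∑ x ^ l = n` the saddle-point upper bound on the number of permutations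
with cycle lengths in `A` is attained up to a polynomial factor. -/
lemma factorial_mul_exp_sum_le (A : Finset ℕ) (hpos : ∀ a ∈ A, 0 < a) {d : ℕ} (hdA : d ∈ A)
    (hd : ∀ l ∈ A, l ≤ d) {n : ℕ} (hn : n ∈ admissibleSizes A) {x : ℝ} (hx : 1 ≤ x)
    (hxn : ∑ l ∈ A, x ^ l = n) (hbig : (A.card * d : ℝ) ≤ x ^ d / d) :
    (n.factorial : ℝ) * Real.exp (∑ l ∈ A, x ^ l / l) ≤
      (Finset.univ.filter (· ∈ permsWithCycleLengthsIn A n)).card * x ^ n *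
        ((n + 1) * Real.exp (1 + (A.card * d) ^ 2 * d)) ^ A.card := by
  obtain ⟨τ, hτ⟩ := hn
  have hx0 : 0 < x := by linarith
  have hl0 : ∀ l ∈ A, (0 : ℝ) < l := fun l hl => by exact_mod_cast hpos l hl
  obtain ⟨m, hm, hmr⟩ := exists_sum_mul_eq_and_abs_sub_le A hdA (hpos d hdA) hd
    (fun l => numCycles l τ) (sum_mul_numCycles A τ hτ) (fun l => x ^ l / l)
    (fun l => by positivity)
    (by
      rw [← hxn]
      refine Finset.sum_congr rfl fun l hl => ?_
      have := hl0 l hl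
      field_simp) hbig
  have key : (n.factorial : ℝ) ≤
      (Finset.univ.filter (· ∈ permsWithCycleLengthsIn A n)).card *
        ∏ l ∈ A, ((l : ℝ) ^ m l * (m l).factorial) := by
    exact_mod_cast factorial_le_card_mul_prod A hpos n m hm
  rw [Real.exp_sum]
  refine (mul_le_mul_of_nonneg_right key (by positivity)).trans ?_
  rw [mul_assoc, mul_assoc, ← Finset.prod_mul_distrib]
  refine mul_le_mul_of_nonneg_left ?_ (Nat.cast_nonneg _)
  have e : x ^ n = ∏ l ∈ A, x ^ (l * m l) := by rw [Finset.prod_pow_eq_pow_sum, hm]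
  rw [e, ← Finset.prod_const, ← Finset.prod_mul_distrib]
  refine Finset.prod_le_prod (fun l _ => by positivity) fun l hl => ?_
  have hlp := hl0 l hl
  have hmn : (m l : ℝ) ≤ n := by
    have h1 : l * m l ≤ n := hm ▸ Finset.single_le_sum (f := fun l => l * m l)
      (fun _ _ => Nat.zero_le _) hl
    exact_mod_cast (Nat.le_mul_of_pos_left _ (hpos l hl)).trans h1
  have hr : 0 < x ^ l / l := by positivity
  have h := factorial_mul_exp_le hr (m l)
  -- Since x ≥ 1, the mean x^l/l is at least 1/d.
  have hinv : ((m l : ℝ) - x ^ l / l) ^ 2 / (x ^ l / l) ≤ (A.card * d) ^ 2 * d := by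
    rw [div_eq_mul_inv]
    refine mul_le_mul (sq_le_sq' ?_ ?_) ?_ (by positivity) (by positivity)
    · exact (abs_le.1 (hmr l hl)).1
    · exact (abs_le.1 (hmr l hl)).2
    · rw [inv_div]
      have h1 : (1 : ℝ) ≤ x ^ l := one_le_pow₀ hx
      have h2 : (l : ℝ) ≤ d := by exact_mod_cast hd l hl
      exact (div_le_self hlp.le h1).trans h2
  calc (l : ℝ) ^ m l * (m l).factorial * Real.exp (x ^ l / l)
      = (l : ℝ) ^ m l * ((m l).factorial * Real.exp (x ^ l / l)) := by ring
    _ ≤ (l : ℝ) ^ m l * ((x ^ l / l) ^ m l *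
        ((m l + 1) * Real.exp (1 + (m l - x ^ l / l) ^ 2 / (x ^ l / l)))) := by gcongr
    _ = x ^ (l * m l) * ((m l + 1) * Real.exp (1 + (m l - x ^ l / l) ^ 2 / (x ^ l / l))) := by
        rw [← mul_assoc, ← mul_pow, mul_div_cancel₀ _ hlp.ne', pow_mul]
    _ ≤ x ^ (l * m l) * ((n + 1) * Real.exp (1 + (A.card * d) ^ 2 * d)) := by gcongr

open Classical in
-- Weights x^k, with an extra factor t at k = l, give each permutation t^(N_l) x^n. The upper bound
-- divided by the saddle-point lower bound leaves the Poisson generating function exp((t - 1)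
-- x^l/l).
lemma sum_pow_numCycles_le (A : Finset ℕ) (hpos : ∀ a ∈ A, 0 < a) {d : ℕ} (hdA : d ∈ A)
    (hd : ∀ l ∈ A, l ≤ d) {n : ℕ} (hn : n ∈ admissibleSizes A) {x : ℝ} (hx : 1 ≤ x)
    (hxn : ∑ l ∈ A, x ^ l = n) (hbig : (A.card * d : ℝ) ≤ x ^ d / d) {l : ℕ} (hl : l ∈ A)
    {t : ℝ} (ht : 0 < t) :
    ∑ σ ∈ Finset.univ.filter (· ∈ permsWithCycleLengthsIn A n), t ^ numCycles l σ ≤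
      (Finset.univ.filter (· ∈ permsWithCycleLengthsIn A n)).card *
        (((n + 1) * Real.exp (1 + (A.card * d) ^ 2 * d)) ^ A.card *
          Real.exp ((t - 1) * (x ^ l / l))) := by
  have hx0 : 0 < x := by linarith
  have h1 := factorial_mul_exp_sum_le A hpos hdA hd hn hx hxn hbig
  have h2 := sum_prod_pow_numCycles_le A hpos n (fun k => (if k = l then t else 1) * x ^ k)
    (fun k => by split_ifs <;> positivity)
  have e1 : ∀ σ ∈ Finset.univ.filter (· ∈ permsWithCycleLengthsIn A n),
      ∏ k ∈ A, ((if k = l then t else 1) * x ^ k) ^ numCycles k σ =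
        t ^ numCycles l σ * x ^ n := by
    intro σ hσ
    simp_rw [mul_pow, Finset.prod_mul_distrib, ← pow_mul]
    rw [Finset.prod_pow_eq_pow_sum, sum_mul_numCycles A σ (Finset.mem_filter.1 hσ).2]
    congr 1
    rw [Finset.prod_eq_single_of_mem l hl fun k _ hk => by rw [if_neg hk, one_pow], if_pos rfl]
  rw [Finset.sum_congr rfl e1, ← Finset.sum_mul, ← Real.exp_sum] at h2
  have e2 : ∑ k ∈ A, (if k = l then t else 1) * x ^ k / k =
      ∑ k ∈ A, x ^ k / (k : ℝ) + (t - 1) * (x ^ l / l) := by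
    rw [← Finset.add_sum_erase A _ hl, ← Finset.add_sum_erase A (fun k : ℕ => x ^ k / (k : ℝ)) hl,
      if_pos rfl, Finset.sum_congr rfl (g := fun k : ℕ => x ^ k / (k : ℝ)) fun k hk => by
        rw [if_neg (Finset.ne_of_mem_erase hk), one_mul]]
    ring
  rw [e2, Real.exp_add, ← mul_assoc] at h2
  have h3 := h2.trans (mul_le_mul_of_nonneg_right h1 (Real.exp_pos _).le)
  refine le_of_mul_le_mul_right (h3.trans (le_of_eq ?_)) (pow_pos hx0 n)
  ring

/-- Positivity of the Poisson large-deviation rate. -/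
lemma sub_one_lt_mul_log {t : ℝ} (ht : 0 < t) (ht1 : t ≠ 1) : t - 1 < t * Real.log t := by
  have h := Real.log_lt_sub_one_of_pos (inv_pos.2 ht) (inv_ne_one.2 ht1)
  rw [Real.log_inv] at h
  have h' := mul_lt_mul_of_pos_left h ht
  rw [mul_sub, mul_inv_cancel₀ ht.ne'] at h'
  linarith

open Classical in
-- Markov's inequality for t^(N_l). The factor log t in the event covers both tails: upper for t >
-- 1, lower for t < 1, where its sign reverses the inequality.
lemma card_filter_exp_le_pow_le (A : Finset ℕ) (hpos : ∀ a ∈ A, 0 < a) {d : ℕ} (hdA : d ∈ A)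
    (hd : ∀ l ∈ A, l ≤ d) {n : ℕ} (hn : n ∈ admissibleSizes A) {x : ℝ} (hx : 1 ≤ x)
    (hxn : ∑ l ∈ A, x ^ l = n) (hbig : (A.card * d : ℝ) ≤ x ^ d / d) {l : ℕ} (hl : l ∈ A)
    {t : ℝ} (ht : 0 < t) :
    (((Finset.univ.filter (· ∈ permsWithCycleLengthsIn A n)).filter fun σ =>
        t * (x ^ l / l) * Real.log t ≤ numCycles l σ * Real.log t).card : ℝ) ≤
      (Finset.univ.filter (· ∈ permsWithCycleLengthsIn A n)).card *
        (((n + 1) * Real.exp (1 + (A.card * d) ^ 2 * d)) ^ A.card *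
          Real.exp (-(t * Real.log t - (t - 1)) * (x ^ l / l))) := by
  have h := sum_pow_numCycles_le A hpos hdA hd hn hx hxn hbig hl ht
  set F := Finset.univ.filter (· ∈ permsWithCycleLengthsIn A n)
  set G := F.filter fun σ : Equiv.Perm (Fin n) => t * (x ^ l / l) * Real.log t ≤ numCycles l σ * Real.log t
  have h1 : (G.card : ℝ) * Real.exp (t * (x ^ l / l) * Real.log t) ≤
      ∑ σ ∈ F, t ^ numCycles l σ := by
    refine le_trans ?_ (Finset.sum_le_sum_of_subset_of_nonneg (s := G)
      (Finset.filter_subset _ F) fun σ _ _ => by positivity)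
    rw [← nsmul_eq_mul]
    refine Finset.card_nsmul_le_sum _ _ _ fun σ hσ => ?_
    rw [← Real.exp_log (pow_pos ht _), Real.log_pow]
    exact Real.exp_le_exp.2 (Finset.mem_filter.1 hσ).2
  refine le_of_mul_le_mul_right ((h1.trans h).trans (le_of_eq ?_))
    (Real.exp_pos (t * (x ^ l / l) * Real.log t))
  rw [mul_assoc, mul_assoc, ← Real.exp_add]
  congr 3
  ring

open Classical in
/-- Chernoff bound: the proportion of permutations whose number of `l`-cycles deviates from
`x ^ l / l` by a factor `ε` is exponentially small in `x`, up to a polynomial factor in `n`. -/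
lemma card_filter_abs_sub_ge_le (A : Finset ℕ) (hpos : ∀ a ∈ A, 0 < a) {d : ℕ} (hdA : d ∈ A)
    (hd : ∀ l ∈ A, l ≤ d) {l : ℕ} (hl : l ∈ A) {ε : ℝ} (hε : 0 < ε) (hε1 : ε < 1) :
    ∃ c > 0, ∀ n ∈ admissibleSizes A, ∀ x : ℝ, 1 ≤ x → ∑ l ∈ A, x ^ l = n →
      (A.card * d : ℝ) ≤ x ^ d / d →
      (((Finset.univ.filter (· ∈ permsWithCycleLengthsIn A n)).filter fun σ =>
        ε * (x ^ l / l) ≤ |(numCycles l σ : ℝ) - x ^ l / l|).card : ℝ) ≤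
      (Finset.univ.filter (· ∈ permsWithCycleLengthsIn A n)).card *
        (2 * (((n + 1) * Real.exp (1 + (A.card * d) ^ 2 * d)) ^ A.card *
          Real.exp (-c * x))) := by
  have hc1 := sub_one_lt_mul_log (t := 1 + ε) (by linarith) (by linarith)
  have hc2 := sub_one_lt_mul_log (t := 1 - ε) (by linarith) (by linarith)
  set c1 := (1 + ε) * Real.log (1 + ε) - (1 + ε - 1) with hc1d
  set c2 := (1 - ε) * Real.log (1 - ε) - (1 - ε - 1) with hc2d
  have hl0 : (0 : ℝ) < l := by exact_mod_cast hpos l hl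
  -- The worse of the two tail rates; x^l is then weakened to x.
  refine ⟨min c1 c2 / l, div_pos (lt_min (by linarith) (by linarith)) hl0,
    fun n hn x hx hxn hbig => ?_⟩
  have h1 := card_filter_exp_le_pow_le A hpos hdA hd hn hx hxn hbig hl (t := 1 + ε) (by linarith)
  have h2 := card_filter_exp_le_pow_le A hpos hdA hd hn hx hxn hbig hl (t := 1 - ε) (by linarith)
  rw [← hc1d] at h1
  rw [← hc2d] at h2
  set F := Finset.univ.filter (· ∈ permsWithCycleLengthsIn A n)
  have hxl : x ≤ x ^ l := le_self_pow₀ hx (hpos l hl).ne'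
  have hmin : 0 < min c1 c2 := lt_min (by linarith) (by linarith)
  have hexp : ∀ c, min c1 c2 ≤ c →
      Real.exp (-c * (x ^ l / l)) ≤ Real.exp (-(min c1 c2 / l) * x) := by
    intro c hc
    refine Real.exp_le_exp.2 ?_
    rw [neg_mul, neg_mul, neg_le_neg_iff, div_mul_eq_mul_div, mul_div_assoc']
    have hc0 : 0 ≤ c := hmin.le.trans hc
    gcongr
  have hsub : (F.filter fun σ => ε * (x ^ l / l) ≤ |(numCycles l σ : ℝ) - x ^ l / l|) ⊆
      (F.filter fun σ => (1 + ε) * (x ^ l / l) * Real.log (1 + ε) ≤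
        numCycles l σ * Real.log (1 + ε)) ∪
      (F.filter fun σ => (1 - ε) * (x ^ l / l) * Real.log (1 - ε) ≤
        numCycles l σ * Real.log (1 - ε)) := by
    intro σ hσ
    obtain ⟨hF, hσ⟩ := Finset.mem_filter.1 hσ
    rw [Finset.mem_union, Finset.mem_filter (s := F), Finset.mem_filter (s := F)]
    rcases le_abs.1 hσ with h | h
    · left
      refine ⟨hF, mul_le_mul_of_nonneg_right (by linarith) (Real.log_nonneg (by linarith))⟩
    · right
      refine ⟨hF, mul_le_mul_of_nonpos_right (by linarith)
        (Real.log_nonpos (by linarith) (by linarith))⟩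
  have hcard : ((F.filter fun σ => ε * (x ^ l / l) ≤
      |(numCycles l σ : ℝ) - x ^ l / l|).card : ℝ) ≤ _ :=
    (Nat.cast_le.2 ((Finset.card_le_card hsub).trans (Finset.card_union_le _ _))).trans
      (le_of_eq (Nat.cast_add _ _))
  refine hcard.trans ((add_le_add h1 h2).trans ?_)
  rw [← mul_add, two_mul, ← mul_add, ← mul_add]
  refine mul_le_mul_of_nonneg_left (mul_le_mul_of_nonneg_left (add_le_add ?_ ?_) (by positivity))
    (Nat.cast_nonneg _)
  · exact hexp c1 (min_le_left _ _)
  · exact hexp c2 (min_le_right _ _)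

/-! ### Asymptotics of the saddle point -/

lemma exists_sum_pow_eq (A : Finset ℕ) (hpos : ∀ a ∈ A, 0 < a) (hA : A.Nonempty) {n : ℕ}
    (hn : A.card ≤ n) : ∃ x : ℝ, 1 ≤ x ∧ ∑ l ∈ A, x ^ l = n := by
  obtain ⟨d, hd⟩ := hA
  have h1n : (1 : ℝ) ≤ n := by exact_mod_cast (Finset.card_pos.2 ⟨d, hd⟩).trans_le hn
  have hcont : ContinuousOn (fun x : ℝ => ∑ l ∈ A, x ^ l) (Set.Icc 1 n) := by fun_prop
  have hmem : (n : ℝ) ∈ Set.Icc (∑ l ∈ A, (1 : ℝ) ^ l) (∑ l ∈ A, (n : ℝ) ^ l) := by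
    constructor
    · simpa using hn
    · exact (le_self_pow₀ h1n (hpos d hd).ne').trans
        (Finset.single_le_sum (f := fun l => (n : ℝ) ^ l) (fun _ _ => by positivity) hd)
  obtain ⟨x, hx, hxn⟩ := intermediate_value_Icc h1n hcont hmem
  exact ⟨x, hx.1, hxn⟩

lemma sum_pow_le_card_mul_pow (A : Finset ℕ) {d : ℕ} (hd : ∀ l ∈ A, l ≤ d) {x : ℝ}
    (hx : 1 ≤ x) : ∑ l ∈ A, x ^ l ≤ A.card * x ^ d := by
  rw [← nsmul_eq_mul]
  exact Finset.sum_le_card_nsmul _ _ _ fun l hl => pow_le_pow_right₀ hx (hd l hl)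

lemma tendsto_atTop_of_sum_pow_eq (A : Finset ℕ) {d : ℕ} (hd : ∀ l ∈ A, l ≤ d) {x : ℕ → ℝ}
    (hx : ∀ᶠ n in atTop, 1 ≤ x n ∧ ∑ l ∈ A, x n ^ l = n) : Tendsto x atTop atTop := by
  refine tendsto_atTop.2 fun b => ?_
  filter_upwards [hx, tendsto_natCast_atTop_atTop.eventually_gt_atTop ((A.card : ℝ) * b ^ d)]
    with n hn hb
  by_contra! h
  have h1 := sum_pow_le_card_mul_pow A hd hn.1
  have h2 : x n ^ d ≤ b ^ d := pow_le_pow_left₀ (by linarith [hn.1]) h.le d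
  rw [hn.2] at h1
  have h3 : (A.card : ℝ) * x n ^ d ≤ A.card * b ^ d := by gcongr
  linarith

/-- In n/x^d = ∑ x^(l - d) only the term l = d survives; then invert and raise to the power l/d. -/
lemma tendsto_pow_div_rpow (A : Finset ℕ) {d : ℕ} (hdA : d ∈ A) (hd0 : 0 < d)
    (hd : ∀ l ∈ A, l ≤ d) {x : ℕ → ℝ}
    (hx : ∀ᶠ n in atTop, 1 ≤ x n ∧ ∑ l ∈ A, x n ^ l = n) (l : ℕ) :
    Tendsto (fun n : ℕ => x n ^ l / (n : ℝ) ^ ((l : ℝ) / d)) atTop (𝓝 1) := by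
  have hxt := tendsto_atTop_of_sum_pow_eq A hd hx
  have h1 : Tendsto (fun n : ℕ => (n : ℝ) / x n ^ d) atTop (𝓝 1) := by
    have h : Tendsto (fun n : ℕ => ∑ l ∈ A, x n ^ l / x n ^ d) atTop
        (𝓝 (∑ l ∈ A, if l = d then 1 else 0)) := by
      refine tendsto_finsetSum _ fun l hl => ?_
      split_ifs with h
      · subst h
        refine tendsto_const_nhds.congr' ?_
        filter_upwards [hx] with n hn
        rw [div_self (pow_pos (by linarith [hn.1]) _).ne']
      · exact (tendsto_pow_div_pow_atTop_zero (lt_of_le_of_ne (hd l hl) h)).comp hxt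
    rw [Finset.sum_ite_eq' A d, if_pos hdA] at h
    refine h.congr' ?_
    filter_upwards [hx] with n hn
    rw [← Finset.sum_div, hn.2]
  have h2 : Tendsto (fun n : ℕ => (x n ^ d / (n : ℝ)) ^ ((l : ℝ) / d)) atTop (𝓝 1) := by
    have h := (h1.inv₀ one_ne_zero).rpow_const (p := (l : ℝ) / d) (Or.inl (by norm_num))
    simpa only [inv_div, inv_one, Real.one_rpow] using h
  refine h2.congr' ?_
  filter_upwards [hx] with n hn
  have hx0 : 0 ≤ x n := by linarith [hn.1]
  rw [Real.div_rpow (by positivity) (by positivity), ← Real.rpow_natCast (x n) d,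
    ← Real.rpow_mul hx0, mul_div_cancel₀ _ (by exact_mod_cast hd0.ne'), Real.rpow_natCast]

/-- By n ≤ |A| x^d, a polynomial in n is bounded by one in x. -/
lemma tendsto_pow_mul_exp_neg (A : Finset ℕ) {d : ℕ} (hd : ∀ l ∈ A, l ≤ d) {x : ℕ → ℝ}
    (hx : ∀ᶠ n in atTop, 1 ≤ x n ∧ ∑ l ∈ A, x n ^ l = n) (k : ℕ) {c : ℝ} (hc : 0 < c) :
    Tendsto (fun n : ℕ => ((n : ℝ) + 1) ^ k * Real.exp (-c * x n)) atTop (𝓝 0) := by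
  have hxt := tendsto_atTop_of_sum_pow_eq A hd hx
  have h1 : Tendsto (fun n : ℕ => ((A.card : ℝ) + 1) ^ k * (x n ^ (d * k) *
      Real.exp (-c * x n))) atTop (𝓝 0) := by
    have h := (((Real.tendsto_pow_mul_exp_neg_atTop_nhds_zero (d * k)).comp
      (hxt.const_mul_atTop hc)).const_mul (((A.card : ℝ) + 1) ^ k / c ^ (d * k)))
    rw [mul_zero] at h
    refine h.congr fun n => ?_
    have : c ^ (d * k) ≠ 0 := by positivity
    simp only [Function.comp_apply, mul_pow, neg_mul]
    field_simp
  refine squeeze_zero' (Eventually.of_forall fun n => by positivity) ?_ h1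
  filter_upwards [hx] with n hn
  rw [← mul_assoc]
  refine mul_le_mul_of_nonneg_right ?_ (Real.exp_pos _).le
  rw [pow_mul, ← mul_pow]
  refine pow_le_pow_left₀ (by positivity) ?_ k
  have h2 := sum_pow_le_card_mul_pow A hd hn.1
  have h3 : 1 ≤ x n ^ d := one_le_pow₀ hn.1
  rw [hn.2] at h2
  linarith

/-! ### From tail bounds to convergence in L^p -/

/-- Minkowski applied to |g| ≤ ε + M · 1_B. -/
lemma eLpNorm_le_add_of_forall_notMem {X : Type*} [MeasurableSpace X] {μ : Measure X}
    [IsProbabilityMeasure μ] {g : X → ℝ} {p : ℝ≥0∞} (hp : 1 ≤ p) (hpt : p ≠ ⊤) {ε M : ℝ}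
    (hε : 0 ≤ ε) (hM : 0 ≤ M) (hgM : ∀ x, |g x| ≤ M) {B : Set X} (hBm : MeasurableSet B)
    (hB : ∀ x ∉ B, |g x| ≤ ε) :
    eLpNorm g p μ ≤ ENNReal.ofReal ε + ENNReal.ofReal M * μ B ^ (1 / p.toReal) := by
  have hp0 : p ≠ 0 := (zero_lt_one.trans_le hp).ne'
  have h1 : eLpNorm g p μ ≤ eLpNorm ((fun _ => ε) + B.indicator fun _ => M) p μ := by
    refine eLpNorm_mono fun x => ?_
    rw [Pi.add_apply, Real.norm_eq_abs, Real.norm_eq_abs]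
    by_cases hx : x ∈ B
    · rw [Set.indicator_of_mem hx, abs_of_nonneg (a := ε + M) (by positivity)]
      linarith [hgM x]
    · rw [Set.indicator_of_notMem hx, add_zero, abs_of_nonneg hε]
      exact hB x hx
  refine h1.trans ((eLpNorm_add_le aestronglyMeasurable_const
    (aestronglyMeasurable_const.indicator hBm) hp).trans ?_)
  rw [eLpNorm_indicator_const hBm hp0 hpt, eLpNorm_const' _ hp0 hpt, measure_univ, ENNReal.one_rpow,
    mul_one, Real.enorm_of_nonneg hε, Real.enorm_of_nonneg hM]

lemma abs_numCycles_div_rpow_sub_le {n : ℕ} (hn : 1 ≤ n) {l : ℕ} (hl : 0 < l) {s : ℝ}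
    (hs : 0 ≤ s) (σ : Equiv.Perm (Fin n)) :
    |(numCycles l σ : ℝ) / (n : ℝ) ^ s - 1 / (l : ℝ)| ≤ n + 1 := by
  have h1 : (numCycles l σ : ℝ) ≤ n := by
    exact_mod_cast (Nat.le_mul_of_pos_left _ hl).trans (mul_numCycles_le l σ)
  have h2 : (1 : ℝ) ≤ (n : ℝ) ^ s := Real.one_le_rpow (by exact_mod_cast hn) hs
  have h3 : (numCycles l σ : ℝ) / (n : ℝ) ^ s ≤ n := (div_le_self (Nat.cast_nonneg _) h2).trans h1
  have h4 : 0 ≤ (numCycles l σ : ℝ) / (n : ℝ) ^ s := by positivity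
  have h5 : 1 / (l : ℝ) ≤ 1 := by
    rw [div_le_one (by exact_mod_cast hl)]
    exact_mod_cast hl
  have h6 : 0 ≤ 1 / (l : ℝ) := by positivity
  have h7 : (0 : ℝ) ≤ n := Nat.cast_nonneg n
  rw [abs_le]
  constructor <;> linarith

open Classical in
lemma uniformOn_permsWithCycleLengthsIn_le (A : Finset ℕ) {n : ℕ} (hn : n ∈ admissibleSizes A)
    (Q : Equiv.Perm (Fin n) → Prop) {δ : ℝ}
    (h : (((Finset.univ.filter (· ∈ permsWithCycleLengthsIn A n)).filter Q).card : ℝ) ≤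
      (Finset.univ.filter (· ∈ permsWithCycleLengthsIn A n)).card * δ) :
    uniformOn (permsWithCycleLengthsIn A n) {σ | Q σ} ≤ ENNReal.ofReal δ := by
  set F := Finset.univ.filter (· ∈ permsWithCycleLengthsIn A n) with hF
  have e1 : permsWithCycleLengthsIn A n = (F : Set (Equiv.Perm (Fin n))) := by
    ext σ
    simp [hF]
  have e2 : permsWithCycleLengthsIn A n ∩ {σ | Q σ} =
      ((F.filter Q : Finset _) : Set (Equiv.Perm (Fin n))) := by
    ext σ
    simp [hF]
  have hne : F.card ≠ 0 := by
    rw [Finset.card_ne_zero, ← Finset.coe_nonempty, ← e1]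
    exact hn
  rw [uniformOn, cond_apply (MeasurableSpace.measurableSet_top), e2, e1,
    Measure.count_apply_finset' MeasurableSpace.measurableSet_top,
    Measure.count_apply_finset' MeasurableSpace.measurableSet_top]
  rw [ENNReal.inv_mul_le_iff (by exact_mod_cast hne) (ENNReal.natCast_ne_top _),
    ← ENNReal.ofReal_natCast, ← ENNReal.ofReal_natCast, ← ENNReal.ofReal_mul (Nat.cast_nonneg _)]
  exact ENNReal.ofReal_le_ofReal h

/-- The convergence in `L^p` of the normalised cycle counts, under the uniform law itself. -/
lemma tendsto_eLpNorm_uniformOn_numCycles (A : Finset ℕ) (hpos : ∀ a ∈ A, 0 < a) {d : ℕ}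
    (hdA : d ∈ A) (hd : ∀ l ∈ A, l ≤ d) {l : ℕ} (hl : l ∈ A) {p : ℝ≥0∞} (hp : 1 ≤ p)
    (hpt : p ≠ ⊤) :
    Tendsto (fun n : ℕ => eLpNorm (fun σ : Equiv.Perm (Fin n) =>
        (numCycles l σ : ℝ) / (n : ℝ) ^ ((l : ℝ) / (d : ℝ)) - 1 / (l : ℝ)) p
        (uniformOn (permsWithCycleLengthsIn A n)))
      (atTop ⊓ 𝓟 (admissibleSizes A)) (𝓝 0) := by
  classical
  have hd0 := hpos d hdA
  have hdR : (0 : ℝ) < d := by exact_mod_cast hd0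
  have hlR : (1 : ℝ) ≤ l := by exact_mod_cast hpos l hl
  have hq : 0 < p.toReal := ENNReal.toReal_pos (zero_lt_one.trans_le hp).ne' hpt
  have hex : ∀ n : ℕ, ∃ x : ℝ, A.card ≤ n → 1 ≤ x ∧ ∑ l ∈ A, x ^ l = n := fun n => by
    by_cases hn : A.card ≤ n
    · obtain ⟨x, hx⟩ := exists_sum_pow_eq A hpos ⟨d, hdA⟩ hn
      exact ⟨x, fun _ => hx⟩
    · exact ⟨0, fun h => absurd h hn⟩
  choose x hx' using hex
  have hx : ∀ᶠ n in atTop, 1 ≤ x n ∧ ∑ l ∈ A, x n ^ l = n :=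
    (eventually_ge_atTop A.card).mono hx'
  have hxt := tendsto_atTop_of_sum_pow_eq A hd hx
  rw [ENNReal.tendsto_nhds_zero]
  intro η hη
  obtain ⟨r, hr0, hrη⟩ := ENNReal.lt_iff_exists_nnreal_btwn.1 hη
  have hr0' : (0 : ℝ) < r := by exact_mod_cast hr0
  -- Off the bad event the error is at most 2ε + ε ≤ r/2; the cap 1/2 ensures ε < 1 for the Chernoff
  -- bound.
  set ε : ℝ := min (1 / 2) (r / 6) with hεdef
  have hε : 0 < ε := lt_min (by norm_num) (by positivity)
  have hε1 : ε ≤ 1 / 2 := min_le_left _ _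
  have hεr : ε ≤ r / 6 := min_le_right _ _
  obtain ⟨c, hc, hcard⟩ := card_filter_abs_sub_ge_le A hpos hdA hd hl hε (by linarith)
  set C : ℝ := Real.exp (1 + (A.card * d) ^ 2 * d)
  -- An integer k ≥ p, so that n + 1 ≤ ((n + 1)^k)^(1/p) and only natural powers meet the
  -- exponential.
  set k := ⌈p.toReal⌉₊
  let δ : ℕ → ℝ := fun n => 2 * ((((n : ℝ) + 1) * C) ^ A.card * Real.exp (-c * x n))
  have hδ0 : ∀ n, 0 ≤ δ n := fun n => by positivity
  have hδt : Tendsto (fun n : ℕ => (((n : ℝ) + 1) ^ k * δ n) ^ (1 / p.toReal)) atTop (𝓝 0) := by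
    have h := (tendsto_pow_mul_exp_neg A hd hx (k + A.card) hc).const_mul (2 * C ^ A.card)
    rw [mul_zero] at h
    have h' := h.rpow_const (p := 1 / p.toReal) (Or.inr (by positivity))
    rw [Real.zero_rpow (by positivity)] at h'
    refine h'.congr fun n => ?_
    congr 1
    simp only [δ, mul_pow, pow_add]
    ring
  rw [eventually_inf_principal]
  have hbig : ∀ᶠ n in atTop, (A.card * d : ℝ) ≤ x n ^ d / d :=
    (((tendsto_pow_atTop hd0.ne').comp hxt).atTop_div_const hdR).eventually_ge_atTop _
  filter_upwards [hx, hbig, eventually_ge_atTop 1, hδt.eventually_lt_const (half_pos hr0'),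
    (tendsto_pow_div_rpow A hdA hd0 hd hx l).eventually (Metric.ball_mem_nhds 1 hε)]
    with n hxn hbn hn1 hδn hρ hnA
  have hρ' : |x n ^ l / (n : ℝ) ^ ((l : ℝ) / d) - 1| < ε := hρ
  have : IsProbabilityMeasure (uniformOn (permsWithCycleLengthsIn A n)) :=
    isProbabilityMeasure_uniformOn (Set.toFinite _) hnA
  have hn0 : (0 : ℝ) < n := by exact_mod_cast hn1
  have hns : (0 : ℝ) < (n : ℝ) ^ ((l : ℝ) / d) := Real.rpow_pos_of_pos hn0 _
  have hbad := uniformOn_permsWithCycleLengthsIn_le A hnA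
    (fun σ => ε * (x n ^ l / l) ≤ |(numCycles l σ : ℝ) - x n ^ l / l|)
    (hcard n hnA (x n) hxn.1 hxn.2 hbn)
  have hmain := eLpNorm_le_add_of_forall_notMem (μ := uniformOn (permsWithCycleLengthsIn A n))
    (g := fun σ : Equiv.Perm (Fin n) =>
      (numCycles l σ : ℝ) / (n : ℝ) ^ ((l : ℝ) / (d : ℝ)) - 1 / (l : ℝ)) hp hpt
    (ε := r / 2) (M := n + 1) (by positivity) (by positivity)
    (fun σ => abs_numCycles_div_rpow_sub_le hn1 (hpos l hl) (by positivity) σ)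
    (B := {σ | ε * (x n ^ l / l) ≤ |(numCycles l σ : ℝ) - x n ^ l / l|})
    MeasurableSpace.measurableSet_top (fun σ hσ => by
      rw [Set.mem_ofPred_eq, not_le] at hσ
      set s := (n : ℝ) ^ ((l : ℝ) / d)
      set ρ := x n ^ l / s with hρdef
      have hl0 : (0 : ℝ) < l := by linarith
      have e : (numCycles l σ : ℝ) / s - 1 / l =
          ((numCycles l σ : ℝ) - x n ^ l / l) / s + (ρ - 1) / l := by
        rw [hρdef]
        field_simp
        ring
      have h1 : |((numCycles l σ : ℝ) - x n ^ l / l) / s| ≤ ε * ρ / l := by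
        rw [abs_div, abs_of_pos hns, div_le_iff₀ hns]
        refine hσ.le.trans (le_of_eq ?_)
        rw [hρdef]
        field_simp
      have h2 : |(ρ - 1) / l| ≤ ε := by
        rw [abs_div, Nat.abs_cast]
        exact (div_le_self (abs_nonneg _) hlR).trans hρ'.le
      have h3 : ρ ≤ 2 := by linarith [(abs_lt.1 hρ').2]
      have h0 : 0 ≤ ρ := by linarith [(abs_lt.1 hρ').1]
      have h4 : ε * ρ / l ≤ ε * 2 :=
        (div_le_self (by positivity) hlR).trans (mul_le_mul_of_nonneg_left h3 hε.le)
      rw [e]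
      exact (abs_add_le _ _).trans (by linarith))
  refine hmain.trans (le_trans ?_ hrη.le)
  have hsecond : ENNReal.ofReal ((n : ℝ) + 1) *
      uniformOn (permsWithCycleLengthsIn A n)
        {σ | ε * (x n ^ l / l) ≤ |(numCycles l σ : ℝ) - x n ^ l / l|} ^ (1 / p.toReal) ≤
      ENNReal.ofReal (r / 2) := by
    calc _ ≤ ENNReal.ofReal ((n : ℝ) + 1) * ENNReal.ofReal (δ n) ^ (1 / p.toReal) := by gcongr
      _ = ENNReal.ofReal (((n : ℝ) + 1) * δ n ^ (1 / p.toReal)) := by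
        rw [ENNReal.ofReal_rpow_of_nonneg (hδ0 n) (by positivity),
          ← ENNReal.ofReal_mul (by positivity)]
      _ ≤ ENNReal.ofReal (r / 2) := by
        refine ENNReal.ofReal_le_ofReal (le_trans ?_ hδn.le)
        rw [Real.mul_rpow (by positivity) (hδ0 n)]
        refine mul_le_mul_of_nonneg_right ?_ (Real.rpow_nonneg (hδ0 n) _)
        have h1 : ((n : ℝ) + 1) ^ p.toReal ≤ ((n : ℝ) + 1) ^ k := by
          rw [← Real.rpow_natCast]
          exact Real.rpow_le_rpow_of_exponent_le (by linarith) (Nat.le_ceil _)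
        have h2 := Real.rpow_le_rpow (by positivity) h1 (z := 1 / p.toReal) (by positivity)
        rwa [← Real.rpow_mul (by positivity), mul_one_div_cancel hq.ne', Real.rpow_one] at h2
  refine (add_le_add le_rfl hsecond).trans (le_of_eq ?_)
  rw [← ENNReal.ofReal_add (by positivity) (by positivity), add_halves, ENNReal.ofReal_coe_nnreal]

/-! ### Transfer to arbitrary probability spaces, and coverage by the longest cycles -/

theorem mainTheorem5 (A : Finset ℕ) (hpos : ∀ a ∈ A, 0 < a) (hA : A.Nonempty)
    {Ω : ℕ → Type*} [∀ n, MeasurableSpace (Ω n)] (P : ∀ n, Measure (Ω n))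
    (σ : ∀ n, Ω n → Equiv.Perm (Fin n))
    (hσ : ∀ n ∈ admissibleSizes A,
      HasLaw (σ n) (uniformOn (permsWithCycleLengthsIn A n)) (P n)) :
    (∀ l ∈ A, ∀ p : ℝ≥0∞, 1 ≤ p → p ≠ ⊤ →
      TendstoConstInLp P (admissibleSizes A)
        (fun n ω => (numCycles l (σ n ω) : ℝ) / (n : ℝ) ^ ((l : ℝ) / (A.max' hA : ℝ)))
        (1 / (l : ℝ)) p) ∧
    (∀ p : ℝ≥0∞, 1 ≤ p → p ≠ ⊤ →
      TendstoConstInLp P (admissibleSizes A)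
        (fun n ω => ((pointsOnCycles (A.max' hA) (σ n ω)).ncard : ℝ) / (n : ℝ)) 1 p) := by
  have hmem : ∀ n ∈ admissibleSizes A, ∀ (g : Equiv.Perm (Fin n) → ℝ) (p : ℝ≥0∞),
      MemLp (fun ω => g (σ n ω)) p (P n) := by
    intro n hn g p
    have : IsProbabilityMeasure (uniformOn (permsWithCycleLengthsIn A n)) :=
      isProbabilityMeasure_uniformOn (Set.toFinite _) hn
    have : DiscreteMeasurableSpace (Equiv.Perm (Fin n)) :=
      ⟨fun _ => MeasurableSpace.measurableSet_top⟩
    have h : MemLp g p ((P n).map (σ n)) := by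
      rw [(hσ n hn).map_eq]
      exact MemLp.of_discrete
    exact (memLp_map_measure_iff h.1 (hσ n hn).aemeasurable).1 h
  have hnorm : ∀ n ∈ admissibleSizes A, ∀ (g : Equiv.Perm (Fin n) → ℝ) (p : ℝ≥0∞),
      eLpNorm g p (uniformOn (permsWithCycleLengthsIn A n)) =
        eLpNorm (fun ω => g (σ n ω)) p (P n) := by
    intro n hn g p
    have hg : AEStronglyMeasurable g ((P n).map (σ n)) :=
      (Measurable.stronglyMeasurable fun _ _ => MeasurableSpace.measurableSet_top).aestronglyMeasurable
    rw [← (hσ n hn).map_eq, eLpNorm_map_measure hg (hσ n hn).aemeasurable]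
    rfl
  have hS : ∀ᶠ n in atTop ⊓ 𝓟 (admissibleSizes A), n ∈ admissibleSizes A :=
    mem_inf_of_right (mem_principal_self _)
  have hconv : ∀ l ∈ A, ∀ p : ℝ≥0∞, 1 ≤ p → p ≠ ⊤ →
      Tendsto (fun n => eLpNorm (fun ω => (numCycles l (σ n ω) : ℝ) /
        (n : ℝ) ^ ((l : ℝ) / (A.max' hA : ℝ)) - 1 / (l : ℝ)) p (P n))
        (atTop ⊓ 𝓟 (admissibleSizes A)) (𝓝 0) := by
    intro l hl p hp hpt
    refine (tendsto_eLpNorm_uniformOn_numCycles A hpos (A.max'_mem hA) (A.le_max') hl hp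
      hpt).congr' ?_
    filter_upwards [hS] with n hn
    exact hnorm n hn _ p
  refine ⟨fun l hl p hp hpt => ⟨fun n hn => hmem n hn (fun τ => (numCycles l τ : ℝ) /
    (n : ℝ) ^ ((l : ℝ) / (A.max' hA : ℝ))) p, hconv l hl p hp hpt⟩, fun p hp hpt =>
    ⟨fun n hn => hmem n hn (fun τ => ((pointsOnCycles (A.max' hA) τ).ncard : ℝ) / (n : ℝ)) p, ?_⟩⟩
  have hd0 : 0 < A.max' hA := hpos _ (A.max'_mem hA)
  have hdR : ((A.max' hA : ℕ) : ℝ) ≠ 0 := by exact_mod_cast hd0.ne'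
  -- Coverage is the case l = d scaled by d: C_n/n - 1 = d (N_d/n - 1/d).
  have h := ENNReal.Tendsto.const_mul (a := ‖((A.max' hA : ℕ) : ℝ)‖ₑ)
    (hconv _ (A.max'_mem hA) p hp hpt) (Or.inr enorm_ne_top)
  rw [mul_zero] at h
  refine h.congr fun n => ?_
  rw [← eLpNorm_const_smul]
  congr 1
  ext ω
  rw [Pi.smul_apply]
  simp only [ncard_pointsOnCycles hd0]
  rw [smul_eq_mul, div_self hdR, Real.rpow_one]
  push_cast
  rw [mul_sub, mul_one_div_cancel hdR, mul_div_assoc]
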